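/- Let $f:[0,\pi]\to\mathbb K$ ($\mathbb K=\mathbb R$ or $\mathbb C$) be of class $C^2$ on $[0,\pi]$, let $\beta>0$, $\gamma>-1$, and let $N\ge1$ be an integer. For $j\in\{0,\dots,N-1\}$ put $s_j=\frac{(2j+1)\pi}{2N}$ and $$I(s_j)=\int_0^\pi\sin^\beta(\eta)\,|\sin(\eta-s_j)|^\gamma f(\eta)\,d\eta .$$ For an integer $r\ge1$ put $h_r=\frac{\pi}{2rN}$ and $\tilde s_t=h_r t$ for $t = n$ and $t=n+\frac12$ (with $n$ an integer), and define $$w_{n,j}=\frac{\operatorname{sgn}(\tilde s_{n+1}-s_j)|\tilde s_{n+1}-s_j|^{\gamma+1}-\operatorname{sgn}(\tilde s_n-s_j)|\tilde s_n-s_j|^{\gamma+1}}{\gamma+1},$$ $$A_{1,j}=\frac1{h_r}\sum_{n=0}^{rN-1}\left(\frac{\sin\tilde s_{n+1/2}}{\tilde s_{n+1/2}}\right)^{\beta}\left(\frac{\sin(\tilde s_{n+1/2}-s_j)}{\tilde s_{n+1/2}-s_j}\right)^{\gamma}\frac{\tilde s_{n+1}^{\beta+1}-\tilde s_n^{\beta+1}}{\beta+1}\,w_{n,j}\,f(\tilde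 s_{n+1/2}),$$ $$A_{2,j}=\frac1{h_r}\sum_{n=rN}^{2rN-1}\left(\frac{\sin\tilde s_{n+1/2}}{\pi-\tilde s_{n+1/2}}\right)^{\beta}\left(\frac{\sin(\tilde s_{n+1/2}-s_j)}{\tilde s_{n+1/2}-s_j}\right)^{\gamma}\frac{(\pi-\tilde s_n)^{\beta+1}-(\pi-\tilde s_{n+1})^{\beta+1}}{\beta+1}\,w_{n,j}\,f(\tilde s_{n+1/2}).$$ Then the integrals $I(s_j)$ converge absolutely, and there is a constant $K>0$, depending on $f,\beta,\gamma,N$ but not on $r$ or $j$, such that for all integers $r\ge1$ and all $j\in\{0,\dots,N-1\}$ $$|I(s_j)-A_{1,j}-A_{2,j}|\le\frac{K}{r^2}.$$ -/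

import Mathlib

open Real

noncomputable section

namespace SingularQuadrature

/-- The step `h_r = π / (2 r N)` of the refined grid. -/
def step (N r : ℕ) : ℝ := π / (2 * r * N)

/-- The points `h_r t` of `[0, π]`; `t = n` gives the node of the refined grid with index `n`,
`t = n + 1/2` the midpoint between the nodes with indices `n` and `n + 1`. -/
def gridPoint (N r : ℕ) (t : ℝ) : ℝ := step N r * t

/-- The evaluation nodes `s_j = (2j+1)π / (2N)`. -/
def evalNode (N j : ℕ) : ℝ := (2 * j + 1) * π / (2 * N)

/-- The integrand `sin^β(η) |sin(η - s)|^γ f(η)`. -/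
def integrand {𝕜 : Type*} [RCLike 𝕜] (β γ : ℝ) (f : ℝ → 𝕜) (s η : ℝ) : 𝕜 :=
  (sin η ^ β * |sin (η - s)| ^ γ) • f η

/-- The singular integral `I(s) = ∫_0^π sin^β(η) |sin(η - s)|^γ f(η) dη`. -/
def singularIntegral {𝕜 : Type*} [RCLike 𝕜] (β γ : ℝ) (f : ℝ → 𝕜) (s : ℝ) : 𝕜 :=
  ∫ η in (0 : ℝ)..π, integrand β γ f s η

/-- The exact integral of `|η - y|^γ` over `[a, b]`, for `γ > -1`, in closed form. -/
def absPowWeight (γ y a b : ℝ) : ℝ :=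
  (Real.sign (b - y) * |b - y| ^ (γ + 1) - Real.sign (a - y) * |a - y| ^ (γ + 1)) / (γ + 1)

/-- The quadrature sum `A_{1,j}` over the cells of `[0, π/2]`. -/
def A₁ {𝕜 : Type*} [RCLike 𝕜] (β γ : ℝ) (f : ℝ → 𝕜) (N r j : ℕ) : 𝕜 :=
  (1 / step N r) • ∑ n ∈ Finset.range (r * N),
    ((sin (gridPoint N r (n + 1 / 2)) / gridPoint N r (n + 1 / 2)) ^ β
      * (sin (gridPoint N r (n + 1 / 2) - evalNode N j)
          / (gridPoint N r (n + 1 / 2) - evalNode N j)) ^ γ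
      * ((gridPoint N r (n + 1) ^ (β + 1) - gridPoint N r n ^ (β + 1)) / (β + 1))
      * absPowWeight γ (evalNode N j) (gridPoint N r n) (gridPoint N r (n + 1)))
    • f (gridPoint N r (n + 1 / 2))

/-- The quadrature sum `A_{2,j}` over the cells of `[π/2, π]`. -/
def A₂ {𝕜 : Type*} [RCLike 𝕜] (β γ : ℝ) (f : ℝ → 𝕜) (N r j : ℕ) : 𝕜 :=
  (1 / step N r) • ∑ n ∈ Finset.Ico (r * N) (2 * r * N),
    ((sin (gridPoint N r (n + 1 / 2)) / (π - gridPoint N r (n + 1 / 2))) ^ β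
      * (sin (gridPoint N r (n + 1 / 2) - evalNode N j)
          / (gridPoint N r (n + 1 / 2) - evalNode N j)) ^ γ
      * (((π - gridPoint N r n) ^ (β + 1) - (π - gridPoint N r (n + 1)) ^ (β + 1)) / (β + 1))
      * absPowWeight γ (evalNode N j) (gridPoint N r n) (gridPoint N r (n + 1)))
    • f (gridPoint N r (n + 1 / 2))

end SingularQuadrature

end

/-! On each half of `[0, π]` the integrand is `u v g`, with `u = x ^ β` or `(π - x) ^ β` monotone,
`v = |x - s| ^ γ`, and `g` of class C². The quadrature is the cellwise product rule `cellError`, so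
it suffices to sum the cell errors on a grid of width `h`.

Away from `s` the factor `v` is C². Expanding `v g` at the midpoint `m` leaves the first-order term
`∫ u (x - m)`, at most `h² |Δu|` because `u` is monotone. These bounds telescope, even where `u` is
not C² at an endpoint.

Near `s` the factor `u` is smooth, and `F = u g` is expanded against the weight `v`. The term `(∫ v
(x - m)) F'(m)` is too large to sum by size when `γ < 0`: next to `s` the moment has order `h ^ (γ +
2)`. Replacing `F'(m)` by `F'(s)` costs `|m - s| |∫ v (x - m)|`, which is `O(h²)` times increments
of the monotone function `(x - s) v(x)`, again telescoping
(`abs_sub_mul_integral_mul_sub_midpoint_le`). What remains is `F'(s)` times the sum of all moments.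
Since `s_j` is a grid node, moments cancel in pairs over a window symmetric about it
(`sum_moment_symmetric`); outside that window they sum to `O(h²)`. -/

namespace SingularQuadrature

open Set MeasureTheory

/-! ### Midpoint expansions and the error on one cell -/

section Generic

variable {E : Type*} [NormedAddCommGroup E] [NormedSpace ℝ E]

/-- On `S`, the function `F` is bounded by `C` and approximated to second order, with constant `C`,
by its first-order expansions with slopes `F'`, which are bounded and Lipschitz. -/
structure QuadApprox (F F' : ℝ → E) (C : ℝ) (S : Set ℝ) : Prop where
  continuousOn : ContinuousOn F S
  nonneg : 0 ≤ C
  norm_le : ∀ x ∈ S, ‖F x‖ ≤ C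
  norm_deriv_le : ∀ x ∈ S, ‖F' x‖ ≤ C
  lipschitz : ∀ x ∈ S, ∀ y ∈ S, ‖F' x - F' y‖ ≤ C * |x - y|
  taylor : ∀ x ∈ S, ∀ y ∈ S, ‖F x - F y - (x - y) • F' y‖ ≤ C * (x - y) ^ 2

lemma exists_quadApprox {F : ℝ → E} {p q : ℝ} (hF : ContDiffOn ℝ 2 F (Icc p q)) :
    ∃ (F' : ℝ → E) (C : ℝ), QuadApprox F F' C (Icc p q) := by
  rcases le_or_gt q p with hqp | hpq
  -- The interval has at most one point here, so the zero slope serves.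
  · refine ⟨0, ‖F p‖, hF.continuousOn, norm_nonneg _, ?_, ?_, ?_, ?_⟩
    · intro x hx
      rw [show x = p by linarith [hx.1, hx.2]]
    · simp
    · intro x _ y _
      simpa using mul_nonneg (norm_nonneg _) (abs_nonneg _)
    · intro x hx y hy
      rw [show x = y by linarith [hx.1, hx.2, hy.1, hy.2]]
      simp
  have hU := uniqueDiffOn_Icc hpq
  have hF1 : ContDiffOn ℝ 1 (derivWithin F (Icc p q)) (Icc p q) :=
    hF.derivWithin hU (by norm_num)
  have hF2 : ContDiffOn ℝ 0 (derivWithin (derivWithin F (Icc p q)) (Icc p q)) (Icc p q) :=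
    hF1.derivWithin hU (by norm_num)
  obtain ⟨C0, h0⟩ := isCompact_Icc.exists_bound_of_continuousOn hF.continuousOn
  obtain ⟨C1, h1⟩ := isCompact_Icc.exists_bound_of_continuousOn hF1.continuousOn
  obtain ⟨C2, h2⟩ := isCompact_Icc.exists_bound_of_continuousOn hF2.continuousOn
  have hD : DifferentiableOn ℝ F (Icc p q) := hF.differentiableOn (by norm_num)
  have hD1 := hF1.differentiableOn (by norm_num)
  have hlip : ∀ x ∈ Icc p q, ∀ y ∈ Icc p q,
      ‖derivWithin F (Icc p q) x - derivWithin F (Icc p q) y‖ ≤ |C2| * |x - y| := by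
    intro x hx y hy
    exact (convex_Icc p q).norm_image_sub_le_of_norm_derivWithin_le hD1
      (fun z hz => (h2 z hz).trans (le_abs_self _)) hy hx
  have hC : 0 ≤ |C0| + |C1| + |C2| := by positivity
  refine ⟨derivWithin F (Icc p q), |C0| + |C1| + |C2|, hF.continuousOn, hC, ?_, ?_, ?_, ?_⟩
  · intro x hx
    linarith [h0 x hx, le_abs_self C0, abs_nonneg C1, abs_nonneg C2]
  · intro x hx
    linarith [h1 x hx, le_abs_self C1, abs_nonneg C0, abs_nonneg C2]
  · intro x hx y hy
    refine (hlip x hx y hy).trans ?_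
    gcongr
    linarith [abs_nonneg C0, abs_nonneg C1]
  · intro x hx y hy
    have hsub : uIcc y x ⊆ Icc p q := (convex_Icc p q).ordConnected.uIcc_subset hy hx
    -- The Taylor bound is the mean value inequality for `F` minus its linear part at `y`, whose
    -- derivative is controlled by the Lipschitz bound.
    have hder : ∀ z ∈ uIcc y x, HasDerivWithinAt
        (fun z => F z - z • derivWithin F (Icc p q) y)
        (derivWithin F (Icc p q) z - derivWithin F (Icc p q) y) (uIcc y x) z := by
      intro z hz
      have h := ((hD z (hsub hz)).hasDerivWithinAt.mono hsub).sub
        ((hasDerivWithinAt_id z (uIcc y x)).smul_const (derivWithin F (Icc p q) y))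
      rw [one_smul] at h
      exact h
    have := (convex_uIcc y x).norm_image_sub_le_of_norm_hasDerivWithin_le
      (C := |C2| * |x - y|) hder (fun z hz => (hlip z (hsub hz) y hy).trans (by
        gcongr ?_ * ?_
        exact abs_sub_left_of_mem_uIcc hz)) left_mem_uIcc right_mem_uIcc
    have e : F x - F y - (x - y) • derivWithin F (Icc p q) y
        = F x - x • derivWithin F (Icc p q) y - (F y - y • derivWithin F (Icc p q) y) := by
      rw [sub_smul]; abel
    rw [e]
    refine this.trans ?_
    rw [Real.norm_eq_abs, mul_assoc, abs_mul_abs_self, ← sq]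
    gcongr
    linarith [abs_nonneg C0, abs_nonneg C1]

lemma abs_sub_midpoint_le {a b x : ℝ} (hx : x ∈ Icc a b) : |x - (a + b) / 2| ≤ b - a := by
  rw [abs_le]
  constructor <;> linarith [hx.1, hx.2]

lemma integral_sub_midpoint (a b : ℝ) : ∫ x in a..b, (x - (a + b) / 2) = 0 := by
  rw [intervalIntegral.integral_sub (by simp) (by simp), integral_id, intervalIntegral.integral_const,
    smul_eq_mul]
  ring

/-- Since `x - m` has mean zero, `u` may be replaced by `u - u a`, which monotonicity bounds by the
increment over the cell. No smoothness of `u` is needed, and the bound telescopes over a grid. -/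
lemma abs_integral_mul_sub_midpoint_le_of_monotoneOn {u : ℝ → ℝ} {a b : ℝ} (hab : a ≤ b)
    (hu : MonotoneOn u (Icc a b)) :
    |∫ x in a..b, u x * (x - (a + b) / 2)| ≤ (b - a) ^ 2 * |u b - u a| := by
  have hui : IntervalIntegrable u volume a b := by
    apply MonotoneOn.intervalIntegrable
    rwa [uIcc_of_le hab]
  have h1 : IntervalIntegrable (fun x => u x * (x - (a + b) / 2)) volume a b :=
    hui.mul_continuousOn (by fun_prop)
  have e : ∫ x in a..b, u x * (x - (a + b) / 2)
      = ∫ x in a..b, (u x - u a) * (x - (a + b) / 2) := by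
    simp_rw [sub_mul (u _) (u a)]
    rw [intervalIntegral.integral_sub h1
      (Continuous.intervalIntegrable (by fun_prop) _ _),
      intervalIntegral.integral_const_mul, integral_sub_midpoint]
    simp
  rw [e, ← Real.norm_eq_abs]
  refine (intervalIntegral.norm_integral_le_of_norm_le_const (C := |u b - u a| * (b - a))
    fun x hx => ?_).trans ?_
  · rw [uIoc_of_le hab] at hx
    have hx' : x ∈ Icc a b := Ioc_subset_Icc_self hx
    rw [norm_mul, Real.norm_eq_abs, Real.norm_eq_abs]
    have h2 := hu (left_mem_Icc.2 hab) hx' hx'.1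
    have h3 := hu hx' (right_mem_Icc.2 hab) hx'.2
    refine mul_le_mul ?_ (abs_sub_midpoint_le hx') (abs_nonneg _) (abs_nonneg _)
    rw [abs_of_nonneg (by linarith), abs_of_nonneg (by linarith)]
    linarith
  · rw [abs_of_nonneg (sub_nonneg.2 hab)]
    apply le_of_eq
    ring

lemma abs_integral_mul_sub_midpoint_le {u : ℝ → ℝ} {a b : ℝ} (hab : a ≤ b)
    (hu : MonotoneOn u (Icc a b) ∨ AntitoneOn u (Icc a b)) :
    |∫ x in a..b, u x * (x - (a + b) / 2)| ≤ (b - a) ^ 2 * |u b - u a| := by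
  rcases hu with hu | hu
  · exact abs_integral_mul_sub_midpoint_le_of_monotoneOn hab hu
  · have := abs_integral_mul_sub_midpoint_le_of_monotoneOn hab hu.neg
    simp only [neg_mul, intervalIntegral.integral_neg, abs_neg] at this
    rwa [← neg_sub' , abs_neg] at this

variable [CompleteSpace E]

/-- The second-order expansion of `F` at the midpoint is integrated against `ω`. The weight need
only be nonnegative and integrable, so either singular factor can play its role. -/
lemma QuadApprox.norm_weighted_midpoint_le {F F' : ℝ → E} {C p q a b : ℝ} {ω : ℝ → ℝ}
    (hF : QuadApprox F F' C (Icc p q)) (ha : p ≤ a) (hab : a ≤ b) (hb : b ≤ q)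
    (hω : IntervalIntegrable ω volume a b) (hω0 : ∀ x ∈ Icc a b, 0 ≤ ω x) :
    ‖(∫ x in a..b, ω x • F x) - (∫ x in a..b, ω x) • F ((a + b) / 2)
        - (∫ x in a..b, ω x * (x - (a + b) / 2)) • F' ((a + b) / 2)‖
      ≤ C * (b - a) ^ 2 * ∫ x in a..b, ω x := by
  have hsub : Icc a b ⊆ Icc p q := Icc_subset_Icc ha hb
  have hm : (a + b) / 2 ∈ Icc p q := hsub ⟨by linarith, by linarith⟩
  have hFi : IntervalIntegrable (fun x => ω x • F x) volume a b := by
    apply hω.smul_continuousOn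
    rw [uIcc_of_le hab]
    exact hF.continuousOn.mono hsub
  have hωi : IntervalIntegrable (fun x => ω x * (x - (a + b) / 2)) volume a b :=
    hω.mul_continuousOn (by fun_prop)
  rw [← intervalIntegral.integral_smul_const, ← intervalIntegral.integral_smul_const,
    ← intervalIntegral.integral_sub hFi (hω.smul_continuousOn continuousOn_const),
    ← intervalIntegral.integral_sub (hFi.sub (hω.smul_continuousOn continuousOn_const)) (hωi.smul_continuousOn continuousOn_const),
    ← intervalIntegral.integral_const_mul]
  refine intervalIntegral.norm_integral_le_of_norm_le hab (ae_of_all _ fun x hx => ?_)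
    (hω.const_mul _)
  have hx' : x ∈ Icc a b := Ioc_subset_Icc_self hx
  rw [← smul_sub, mul_smul, ← smul_sub, norm_smul, Real.norm_eq_abs, abs_of_nonneg (hω0 x hx'),
    mul_comm]
  refine mul_le_mul_of_nonneg_right ((hF.taylor x (hsub hx') _ hm).trans ?_) (hω0 x hx')
  refine mul_le_mul_of_nonneg_left ?_ hF.nonneg
  rw [← sq_abs]
  exact pow_le_pow_left₀ (abs_nonneg _) (abs_sub_midpoint_le hx') 2

/-- For the constant weight the first moment vanishes, so the mean value agrees with the midpoint
value to second order. -/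
lemma QuadApprox.abs_integral_sub_midpoint_le {F F' : ℝ → ℝ} {C p q a b : ℝ}
    (hF : QuadApprox F F' C (Icc p q)) (ha : p ≤ a) (hab : a < b) (hb : b ≤ q) :
    |(∫ x in a..b, F x) / (b - a) - F ((a + b) / 2)| ≤ C * (b - a) ^ 2 := by
  have h := hF.norm_weighted_midpoint_le (ω := fun _ => 1) ha hab.le hb (by simp) (by simp)
  simp only [one_mul, integral_sub_midpoint, smul_eq_mul, intervalIntegral.integral_const,
    mul_one, zero_mul, sub_zero, Real.norm_eq_abs] at h
  have hpos : 0 < b - a := sub_pos.2 hab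
  rw [show (∫ x in a..b, F x) / (b - a) - F ((a + b) / 2)
    = ((∫ x in a..b, F x) - (b - a) * F ((a + b) / 2)) / (b - a) by field_simp, abs_div,
    abs_of_pos hpos, div_le_iff₀ hpos]
  exact h

/-- Error of the product rule `∫ u v g ≈ (b - a)⁻¹ (∫ u) (∫ v) g(m)` on one cell `[a, b]` with
midpoint `m`. -/
noncomputable def cellError (u v : ℝ → ℝ) (g : ℝ → E) (a b : ℝ) : E :=
  (∫ x in a..b, (u x * v x) • g x)
    - ((∫ x in a..b, u x) * (∫ x in a..b, v x) / (b - a)) • g ((a + b) / 2)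

/-- Bound for cells away from the singularity: `v g` is expanded at the midpoint against the weight
`u`, and `v` at the midpoint is then traded for its mean. The factor `(b - a) + |u b - u a|` has
bounded sum over a grid. -/
lemma exists_norm_cellError_le_of_monotone {u v : ℝ → ℝ} {g : ℝ → E} {p q : ℝ}
    (hu : MonotoneOn u (Icc p q) ∨ AntitoneOn u (Icc p q)) (hu0 : ∀ x ∈ Icc p q, 0 ≤ u x)
    (hv : ContDiffOn ℝ 2 v (Icc p q)) (hg : ContDiffOn ℝ 2 g (Icc p q)) :
    ∃ K, 0 ≤ K ∧ ∀ a b, p ≤ a → a < b → b ≤ q →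
      ‖cellError u v g a b‖ ≤ K * (b - a) ^ 2 * ((b - a) + |u b - u a|) := by
  obtain ⟨v', C₁, hv'⟩ := exists_quadApprox hv
  obtain ⟨G', C₂, hG'⟩ := exists_quadApprox (hv.smul hg)
  obtain ⟨g', C₃, hg'⟩ := exists_quadApprox hg
  have hC₁ := hv'.nonneg
  have hC₂ := hG'.nonneg
  have hC₃ := hg'.nonneg
  set U := |u p| + |u q|
  have hU : 0 ≤ U := by positivity
  refine ⟨C₂ * U + C₂ + U * C₁ * C₃, by positivity, fun a b ha hab hb => ?_⟩
  have hsub : Icc a b ⊆ Icc p q := Icc_subset_Icc ha hb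
  have hpq : p ≤ q := by linarith
  have hm : (a + b) / 2 ∈ Icc p q := hsub ⟨by linarith, by linarith⟩
  have hu' : MonotoneOn u (Icc a b) ∨ AntitoneOn u (Icc a b) :=
    hu.imp (fun h => h.mono hsub) (fun h => h.mono hsub)
  have hui : IntervalIntegrable u volume a b := by
    rw [← uIcc_of_le hab.le] at hu'
    exact hu'.elim (fun h => h.intervalIntegrable) (fun h => h.intervalIntegrable)
  have huU : ∀ x ∈ Icc p q, u x ≤ U := by
    intro x hx
    rcases hu with h | h
    · exact (h hx (right_mem_Icc.2 hpq) hx.2).trans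
        (by linarith [le_abs_self (u q), abs_nonneg (u p)])
    · exact (h (left_mem_Icc.2 hpq) hx hx.1).trans
        (by linarith [le_abs_self (u p), abs_nonneg (u q)])
  have hI0 : 0 ≤ ∫ x in a..b, u x :=
    intervalIntegral.integral_nonneg hab.le fun x hx => hu0 x (hsub hx)
  have hIU : ∫ x in a..b, u x ≤ U * (b - a) := by
    have := intervalIntegral.integral_mono_on hab.le hui (by simp)
      (g := fun _ => U) fun x hx => huU x (hsub hx)
    simpa [mul_comm] using this
  have h1 := hG'.norm_weighted_midpoint_le ha hab.le hb hui fun x hx => hu0 x (hsub hx)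
  have h2 := abs_integral_mul_sub_midpoint_le hab.le hu'
  have h3 := hv'.abs_integral_sub_midpoint_le ha hab hb
  set m := (a + b) / 2 with hmdef
  set J := ∫ x in a..b, u x
  set D := ∫ x in a..b, u x * (x - m)
  set V := ∫ x in a..b, v x
  have hpos : 0 < b - a := sub_pos.2 hab
  have e : cellError u v g a b = ((∫ x in a..b, u x • (v x • g x)) - J • (v m • g m) - D • G' m)
      + D • G' m - (J * (V / (b - a) - v m)) • g m := by
    have e' : cellError u v g a b
        = (∫ x in a..b, u x • (v x • g x)) - (J * V / (b - a)) • g m := by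
      simp only [cellError, mul_smul, J, V, hmdef]
    rw [e', mul_div_assoc, mul_sub, sub_smul, smul_smul J]
    abel
  rw [e]
  refine (norm_sub_le _ _).trans ?_
  refine (add_le_add (norm_add_le _ _) le_rfl).trans ?_
  have hD : ‖D • G' m‖ ≤ ((b - a) ^ 2 * |u b - u a|) * C₂ := by
    rw [norm_smul]
    exact mul_le_mul h2 (hG'.norm_deriv_le m hm) (norm_nonneg _) (by positivity)
  have hL : ‖(J * (V / (b - a) - v m)) • g m‖ ≤ (U * (b - a)) * (C₁ * (b - a) ^ 2) * C₃ := by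
    rw [norm_smul, norm_mul, Real.norm_eq_abs, Real.norm_eq_abs, abs_of_nonneg hI0]
    exact mul_le_mul (mul_le_mul hIU h3 (abs_nonneg _) (by positivity)) (hg'.norm_le m hm)
      (norm_nonneg _) (by positivity)
  have hT := h1.trans (mul_le_mul_of_nonneg_left hIU (by positivity))
  refine (add_le_add (add_le_add hT hD) hL).trans ?_
  have hΔ := abs_nonneg (u b - u a)
  have : 0 ≤ (C₂ * (b - a) + (C₂ * U + U * C₁ * C₃) * |u b - u a|) * (b - a) ^ 2 := by positivity
  nlinarith [this]

/-- Writing `m - s = (x - s) - (x - m)` under the integral splits the product into the first moment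
of the monotone function `(x - s) v(x)` and a second moment of `v`, each of order `(b - a)²`. -/
lemma abs_sub_mul_integral_mul_sub_midpoint_le {v : ℝ → ℝ} {a b s : ℝ} (hab : a ≤ b)
    (hv0 : ∀ x, 0 ≤ v x) (hvi : IntervalIntegrable v volume a b)
    (hvm : Monotone fun x => v x * (x - s)) :
    |(a + b) / 2 - s| * |∫ x in a..b, v x * (x - (a + b) / 2)|
      ≤ (b - a) ^ 2 * ((∫ x in a..b, v x) + (v b * (b - s) - v a * (a - s))) := by
  have h1 := abs_integral_mul_sub_midpoint_le_of_monotoneOn hab (hvm.monotoneOn (Icc a b))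
  rw [abs_of_nonneg (sub_nonneg.2 (hvm hab))] at h1
  set m := (a + b) / 2 with hm
  have hi1 : IntervalIntegrable (fun x => v x * (x - s) * (x - m)) volume a b :=
    (hvi.mul_continuousOn (by fun_prop)).mul_continuousOn (by fun_prop)
  have hi2 : IntervalIntegrable (fun x => v x * (x - m) ^ 2) volume a b :=
    hvi.mul_continuousOn (by fun_prop)
  have e : (m - s) * (∫ x in a..b, v x * (x - m))
      = (∫ x in a..b, v x * (x - s) * (x - m)) - ∫ x in a..b, v x * (x - m) ^ 2 := by
    rw [← intervalIntegral.integral_sub hi1 hi2, ← intervalIntegral.integral_const_mul]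
    congr 1
    ext x
    ring
  have h2 : |∫ x in a..b, v x * (x - m) ^ 2| ≤ (b - a) ^ 2 * ∫ x in a..b, v x := by
    rw [abs_of_nonneg (intervalIntegral.integral_nonneg hab fun x _ => by
      have := hv0 x
      positivity), ← intervalIntegral.integral_const_mul]
    refine intervalIntegral.integral_mono_on hab hi2 (hvi.const_mul _) fun x hx => ?_
    rw [mul_comm]
    refine mul_le_mul_of_nonneg_right ?_ (hv0 x)
    rw [← sq_abs]
    exact pow_le_pow_left₀ (abs_nonneg _) (abs_sub_midpoint_le hx) 2
  rw [← abs_mul, e, mul_add]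
  refine (abs_sub _ _).trans ?_
  linarith

/-- Error bound on cells where the weight `v` is merely integrable: the leading part
`(∫ v (x - m)) F'(s)` is split off, and what remains is controlled by the increments of the
monotone function `(x - s) v(x)` and of `∫ v`. -/
lemma exists_norm_cellError_sub_le {u v : ℝ → ℝ} {g F F' : ℝ → E} {p q p' q' s C : ℝ}
    (hF : QuadApprox F F' C (Icc p' q')) (hs : s ∈ Icc p' q') (hp : p' ≤ p) (hq : q ≤ q')
    (hu : ContDiffOn ℝ 2 u (Icc p q)) (hg : ContinuousOn g (Icc p q))
    (hFug : ∀ x ∈ Icc p q, F x = u x • g x)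
    (hv0 : ∀ x, 0 ≤ v x) (hvi : ∀ a b, IntervalIntegrable v volume a b)
    (hvm : Monotone fun x => v x * (x - s)) :
    ∃ K, 0 ≤ K ∧ ∀ a b, p ≤ a → a < b → b ≤ q →
      ‖cellError u v g a b - (∫ x in a..b, v x * (x - (a + b) / 2)) • F' s‖
        ≤ K * (b - a) ^ 2 * ((∫ x in a..b, v x) + (v b * (b - s) - v a * (a - s))) := by
  obtain ⟨u', C₁, hu'⟩ := exists_quadApprox hu
  obtain ⟨C₂, hC₂'⟩ := isCompact_Icc.exists_bound_of_continuousOn hg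
  have hC := hF.nonneg
  have hC₁ := hu'.nonneg
  -- One `C` is the Taylor error, the other the passage from `F' m` to `F' s`; `C₁ * |C₂|` pays for
  -- replacing `u m` by the mean of `u`.
  refine ⟨2 * C + C₁ * |C₂|, by positivity, fun a b ha hab hb => ?_⟩
  have hsub : Icc a b ⊆ Icc p q := Icc_subset_Icc ha hb
  have hm : (a + b) / 2 ∈ Icc p q := hsub ⟨by linarith, by linarith⟩
  have hm' : (a + b) / 2 ∈ Icc p' q' := Icc_subset_Icc hp hq hm
  have h1 := hF.norm_weighted_midpoint_le (hp.trans ha) hab.le (hb.trans hq) (hvi a b)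
    fun x _ => hv0 x
  have h2 := abs_sub_mul_integral_mul_sub_midpoint_le hab.le hv0 (hvi a b) hvm
  have h3 := hu'.abs_integral_sub_midpoint_le ha hab hb
  have hV : 0 ≤ ∫ x in a..b, v x := intervalIntegral.integral_nonneg hab.le fun x _ => hv0 x
  have hW : 0 ≤ v b * (b - s) - v a * (a - s) := sub_nonneg.2 (hvm hab.le)
  have hFm := hFug _ hm
  have hFI : ∫ x in a..b, v x • F x = ∫ x in a..b, (u x * v x) • g x := by
    refine intervalIntegral.integral_congr fun x hx => ?_
    rw [uIcc_of_le hab.le] at hx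
    simp only [hFug x (hsub hx), smul_smul, mul_comm]
  rw [hFI] at h1
  have hLip := hF.lipschitz _ hm' _ hs
  have hgm := (hC₂' _ hm).trans (le_abs_self _)
  unfold cellError
  set m := (a + b) / 2 with hmdef
  set J := ∫ x in a..b, u x
  set D := ∫ x in a..b, v x * (x - m)
  set V := ∫ x in a..b, v x
  set I := ∫ x in a..b, (u x * v x) • g x
  set W := v b * (b - s) - v a * (a - s)
  have e : I - (J * V / (b - a)) • g m - D • F' s
      = (I - V • F m - D • F' m) + D • (F' m - F' s) - (V * (J / (b - a) - u m)) • g m := by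
    rw [hFm, smul_smul, smul_sub, mul_sub, sub_smul, mul_comm J V, mul_div_assoc]
    abel
  rw [e]
  refine (norm_sub_le _ _).trans ?_
  refine (add_le_add (norm_add_le _ _) le_rfl).trans ?_
  have hD : ‖D • (F' m - F' s)‖ ≤ C * ((b - a) ^ 2 * (V + W)) := by
    rw [norm_smul, Real.norm_eq_abs]
    calc |D| * ‖F' m - F' s‖ ≤ |D| * (C * |m - s|) := by gcongr
      _ = C * (|m - s| * |D|) := by ring
      _ ≤ _ := by gcongr
  have hL : ‖(V * (J / (b - a) - u m)) • g m‖ ≤ V * (C₁ * (b - a) ^ 2) * |C₂| := by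
    rw [norm_smul, norm_mul, Real.norm_eq_abs, Real.norm_eq_abs, abs_of_nonneg hV]
    gcongr
  refine (add_le_add (add_le_add h1 hD) hL).trans ?_
  have : 0 ≤ (C + C₁ * |C₂|) * (b - a) ^ 2 * W := by positivity
  linarith

end Generic

/-! ### The function `sinc`, the weight `|x - s| ^ γ` and its moments -/

section Weights

lemma contDiff_sinc {n : WithTop ℕ∞} : ContDiff ℝ n sinc := by
  rw [contDiff_iff_contDiffAt]
  intro x
  apply AnalyticAt.contDiffAt
  rcases eq_or_ne x 0 with rfl | hx
  -- At the origin `sinc` is the divided slope of `sin`, whose power series is the shifted series of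
  -- `sin`.
  · obtain ⟨p, hp⟩ : AnalyticAt ℝ sin 0 := analyticAt_sin
    rw [sinc_eq_dslope]
    exact ⟨_, hp.has_fpower_series_dslope_fslope⟩
  · have h : AnalyticAt ℝ (fun y => sin y / y) x := analyticAt_sin.div analyticAt_id hx
    refine h.congr ?_
    filter_upwards [isOpen_ne.mem_nhds hx] with y hy
    exact (sinc_of_ne_zero hy).symm

lemma sinc_pos_of_abs_lt_pi {x : ℝ} (hx : |x| < π) : 0 < sinc x := by
  rcases eq_or_ne x 0 with rfl | h0
  · simp
  have h : sinc x = sinc |x| := by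
    rcases abs_cases x with ⟨h, -⟩ | ⟨h, -⟩ <;> simp [h]
  rw [h, sinc_of_ne_zero (abs_ne_zero.2 h0)]
  exact div_pos (sin_pos_of_pos_of_lt_pi (abs_pos.2 h0) hx) (abs_pos.2 h0)

lemma sin_eq_mul_sinc (x : ℝ) : sin x = x * sinc x := by
  rcases eq_or_ne x 0 with rfl | h0
  · simp
  · rw [sinc_of_ne_zero h0]
    field_simp

variable {γ : ℝ}

lemma intervalIntegrable_abs_rpow (hγ : -1 < γ) (a b : ℝ) :
    IntervalIntegrable (fun x : ℝ => |x| ^ γ) volume a b := by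
  have hpos : ∀ c, 0 ≤ c → IntervalIntegrable (fun x : ℝ => |x| ^ γ) volume 0 c := by
    intro c hc
    refine (intervalIntegral.intervalIntegrable_rpow' hγ).congr fun x hx => ?_
    rw [uIoc_of_le hc] at hx
    simp only [abs_of_pos hx.1]
  have h0 : ∀ c, IntervalIntegrable (fun x : ℝ => |x| ^ γ) volume 0 c := by
    intro c
    rcases le_total 0 c with hc | hc
    · exact hpos c hc
    · have := (hpos (-c) (by linarith)).comp_sub_left 0
      simpa using this
  exact (h0 a).symm.trans (h0 b)

lemma intervalIntegrable_abs_sub_rpow (hγ : -1 < γ) (s a b : ℝ) :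
    IntervalIntegrable (fun x : ℝ => |x - s| ^ γ) volume a b := by
  have := (intervalIntegrable_abs_rpow hγ (a - s) (b - s)).comp_sub_right s
  simpa using this

lemma integral_zero_abs_rpow (hγ : -1 < γ) (c : ℝ) :
    ∫ x in (0 : ℝ)..c, |x| ^ γ = Real.sign c * |c| ^ (γ + 1) / (γ + 1) := by
  have hpos : ∀ c, 0 < c → ∫ x in (0 : ℝ)..c, |x| ^ γ = c ^ (γ + 1) / (γ + 1) := by
    intro c hc
    have h : ∫ x in (0 : ℝ)..c, |x| ^ γ = ∫ x in (0 : ℝ)..c, x ^ γ := by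
      refine intervalIntegral.integral_congr fun x hx => ?_
      rw [uIcc_of_le hc.le] at hx
      simp only [abs_of_nonneg hx.1]
    rw [h, integral_rpow (Or.inl hγ), zero_rpow (by linarith), sub_zero]
  rcases lt_trichotomy c 0 with hc | rfl | hc
  · have h := intervalIntegral.integral_comp_neg (a := (0 : ℝ)) (b := c) fun x : ℝ => |x| ^ γ
    simp only [abs_neg, neg_zero] at h
    rw [h, intervalIntegral.integral_symm, hpos (-c) (by linarith), Real.sign_of_neg hc,
      abs_of_neg hc]
    ring
  · simp
  · rw [hpos c hc, Real.sign_of_pos hc, abs_of_pos hc, one_mul]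

lemma integral_abs_sub_rpow (hγ : -1 < γ) (s a b : ℝ) :
    ∫ x in a..b, |x - s| ^ γ = absPowWeight γ s a b := by
  rw [intervalIntegral.integral_comp_sub_right (fun x : ℝ => |x| ^ γ),
    ← intervalIntegral.integral_interval_sub_left (intervalIntegrable_abs_rpow hγ 0 (b - s))
      (intervalIntegrable_abs_rpow hγ 0 (a - s)), integral_zero_abs_rpow hγ,
    integral_zero_abs_rpow hγ, absPowWeight, sub_div]

lemma abs_rpow_mul_self (γ x : ℝ) :
    |x| ^ γ * x = Real.sign x * |x| ^ (γ + 1) := by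
  rcases eq_or_ne x 0 with rfl | h0
  · simp
  · rw [rpow_add_one (abs_ne_zero.2 h0)]
    rcases lt_or_gt_of_ne h0 with h | h
    · rw [Real.sign_of_neg h, abs_of_neg h]; ring
    · rw [Real.sign_of_pos h, abs_of_pos h]; ring

lemma integral_abs_sub_rpow_eq (hγ : -1 < γ) (s a b : ℝ) :
    ∫ x in a..b, |x - s| ^ γ
      = (|b - s| ^ γ * (b - s) - |a - s| ^ γ * (a - s)) / (γ + 1) := by
  rw [integral_abs_sub_rpow hγ, absPowWeight, abs_rpow_mul_self, abs_rpow_mul_self]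

/-- Its increments are `γ + 1` times integrals of `|x - s| ^ γ`, so this holds even for negative
`γ`. -/
lemma monotone_abs_sub_rpow_mul (hγ : -1 < γ) (s : ℝ) :
    Monotone fun x : ℝ => |x - s| ^ γ * (x - s) := by
  intro a b hab
  have h := intervalIntegral.integral_nonneg (f := fun x : ℝ => |x - s| ^ γ) hab
    (fun x _ => by positivity) (μ := volume)
  rw [integral_abs_sub_rpow_eq hγ] at h
  have h1 : 0 < γ + 1 := by linarith
  have := (div_nonneg_iff.1 h).resolve_right (by rintro ⟨-, h2⟩; linarith)
  simpa using this.1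

/-- First moment of `|x - s|^γ` over `[a, b]` about the midpoint. -/
noncomputable def moment (γ s a b : ℝ) : ℝ :=
  ∫ x in a..b, |x - s| ^ γ * (x - (a + b) / 2)

lemma moment_reflect (γ s a b : ℝ) : moment γ s (2 * s - b) (2 * s - a) = -moment γ s a b := by
  unfold moment
  rw [← intervalIntegral.integral_comp_sub_left
    (fun x => |x - s| ^ γ * (x - (2 * s - b + (2 * s - a)) / 2)) (2 * s),
    ← intervalIntegral.integral_neg]
  congr 1
  ext x
  rw [show 2 * s - x - s = -(x - s) by ring, abs_neg]
  ring

/-- Reflection about the node `h (k + r)` swaps the `2r` cells in pairs and reverses the sign of the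
moment, so the sum equals its own negative. -/
lemma sum_moment_symmetric (γ h : ℝ) (k r : ℕ) :
    ∑ i ∈ Finset.range (2 * r),
      moment γ (h * (k + r)) (h * ((k + i : ℕ) : ℝ)) (h * (((k + i : ℕ) : ℝ) + 1)) = 0 := by
  have h1 := Finset.sum_range_reflect (fun i : ℕ =>
    moment γ (h * (k + r)) (h * ((k + i : ℕ) : ℝ)) (h * (((k + i : ℕ) : ℝ) + 1))) (2 * r)
  have h2 : ∀ i ∈ Finset.range (2 * r),
      moment γ (h * (k + r)) (h * ((k + (2 * r - 1 - i) : ℕ) : ℝ))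
        (h * (((k + (2 * r - 1 - i) : ℕ) : ℝ) + 1))
      = -moment γ (h * (k + r)) (h * ((k + i : ℕ) : ℝ)) (h * (((k + i : ℕ) : ℝ) + 1)) := by
    intro i hi
    rw [← moment_reflect]
    have e : ((2 * r - 1 - i : ℕ) : ℝ) = 2 * r - 1 - i := by
      have := Finset.mem_range.1 hi
      rw [Nat.cast_sub (by omega), Nat.cast_sub (by omega)]
      push_cast
      ring
    push_cast
    rw [e]
    congr 1 <;> ring
  rw [Finset.sum_congr rfl h2, Finset.sum_neg_distrib] at h1
  linarith

lemma abs_sub_mul_abs_moment_le (hγ : -1 < γ) {s a b : ℝ} (hab : a ≤ b) :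
    |(a + b) / 2 - s| * |moment γ s a b|
      ≤ (1 / (γ + 1) + 1) * (b - a) ^ 2
        * (|b - s| ^ γ * (b - s) - |a - s| ^ γ * (a - s)) := by
  have := abs_sub_mul_integral_mul_sub_midpoint_le (v := fun x => |x - s| ^ γ) hab
    (fun x => by positivity) (intervalIntegrable_abs_sub_rpow hγ s a b)
    (monotone_abs_sub_rpow_mul hγ s)
  rw [integral_abs_sub_rpow_eq hγ] at this
  refine this.trans (le_of_eq ?_)
  ring

lemma contDiffOn_abs_sub_rpow {s p q : ℝ} (hs : s ∉ Icc p q) :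
    ContDiffOn ℝ 2 (fun x : ℝ => |x - s| ^ γ) (Icc p q) := by
  intro x hx
  have hne : x - s ≠ 0 := sub_ne_zero.2 fun h => hs (h ▸ hx)
  have h1 : ContDiffAt ℝ 2 (fun x : ℝ => |x - s|) x :=
    (contDiffAt_abs hne).comp x (contDiffAt_id.sub contDiffAt_const)
  exact (h1.rpow_const_of_ne (abs_ne_zero.2 hne)).contDiffWithinAt

end Weights

/-! ### Cell errors summed over a grid -/

section Cells

variable {E : Type*} [NormedAddCommGroup E] [NormedSpace ℝ E] [CompleteSpace E] {γ : ℝ}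

/-- Subtracting the moment is harmless at distance `η` from `s`, where it is itself second order.
This gives far cells the same form of bound as near ones. -/
lemma exists_norm_cellError_sub_moment_le_of_far (hγ : -1 < γ) {u : ℝ → ℝ} {g : ℝ → E}
    {p q s η : ℝ} (y : E) (hη : 0 < η)
    (hu : MonotoneOn u (Icc p q) ∨ AntitoneOn u (Icc p q)) (hu0 : ∀ x ∈ Icc p q, 0 ≤ u x)
    (hg : ContDiffOn ℝ 2 g (Icc p q)) (hs : ∀ x ∈ Icc p q, η ≤ |x - s|) :
    ∃ K, 0 ≤ K ∧ ∀ a b, p ≤ a → a < b → b ≤ q →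
      ‖cellError u (fun x => |x - s| ^ γ) g a b - moment γ s a b • y‖
        ≤ K * (b - a) ^ 2 * ((b - a) + |u b - u a|
          + (|b - s| ^ γ * (b - s) - |a - s| ^ γ * (a - s))) := by
  have hs' : s ∉ Icc p q := fun h => by
    have := hs s h
    simp at this
    linarith
  obtain ⟨K, hK, H⟩ := exists_norm_cellError_le_of_monotone hu hu0
    (contDiffOn_abs_sub_rpow (γ := γ) hs') hg
  have h1 : 0 < γ + 1 := by linarith
  refine ⟨K + (1 / (γ + 1) + 1) / η * ‖y‖, by positivity, fun a b ha hab hb => ?_⟩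
  have hm := hs ((a + b) / 2) ⟨by linarith, by linarith⟩
  have hM := abs_sub_mul_abs_moment_le hγ (s := s) hab.le
  have hW : 0 ≤ |b - s| ^ γ * (b - s) - |a - s| ^ γ * (a - s) :=
    sub_nonneg.2 (monotone_abs_sub_rpow_mul hγ s hab.le)
  have hΔ := abs_nonneg (u b - u a)
  have hba : 0 < b - a := sub_pos.2 hab
  set W := |b - s| ^ γ * (b - s) - |a - s| ^ γ * (a - s)
  have hM' : |moment γ s a b| ≤ (1 / (γ + 1) + 1) / η * (b - a) ^ 2 * W := by
    rw [div_mul_eq_mul_div, div_mul_eq_mul_div, le_div_iff₀ hη, mul_comm]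
    exact (mul_le_mul_of_nonneg_right hm (abs_nonneg _)).trans hM
  refine (norm_sub_le _ _).trans ?_
  rw [norm_smul, Real.norm_eq_abs]
  refine (add_le_add (H a b ha hab hb)
    (mul_le_mul_of_nonneg_right hM' (norm_nonneg y))).trans ?_
  have e1 : 0 ≤ K * (b - a) ^ 2 * W := by positivity
  have e2 : 0 ≤ (1 / (γ + 1) + 1) / η * ‖y‖ * (b - a) ^ 2 * ((b - a) + |u b - u a|) := by
    positivity
  linarith

/-- On `[c, d]`, cells of width less than `δ` satisfy one error bound, whether or not they are
close to the singularity `s`. -/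
lemma exists_norm_cellError_sub_moment_le (hγ : -1 < γ) {u : ℝ → ℝ} {g F F' : ℝ → E}
    {c d s δ C : ℝ} (hδ : 0 < δ)
    (hu : MonotoneOn u (Icc c d) ∨ AntitoneOn u (Icc c d)) (hu0 : ∀ x ∈ Icc c d, 0 ≤ u x)
    (hg : ContDiffOn ℝ 2 g (Icc c d))
    (hF : QuadApprox F F' C (Icc (s - 2 * δ) (s + 2 * δ)))
    (hu2 : ContDiffOn ℝ 2 u (Icc (max c (s - 2 * δ)) (min d (s + 2 * δ))))
    (hFug : ∀ x ∈ Icc (max c (s - 2 * δ)) (min d (s + 2 * δ)), F x = u x • g x) :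
    ∃ K, 0 ≤ K ∧ ∀ a b, c ≤ a → a < b → b ≤ d → b - a < δ →
      ‖cellError u (fun x => |x - s| ^ γ) g a b - moment γ s a b • F' s‖
        ≤ K * (b - a) ^ 2 * ((b - a) + |u b - u a|
          + (|b - s| ^ γ * (b - s) - |a - s| ^ γ * (a - s))) := by
  have hsubL : Icc c (min d (s - δ)) ⊆ Icc c d := Icc_subset_Icc le_rfl (min_le_left _ _)
  have hsubR : Icc (max c (s + δ)) d ⊆ Icc c d := Icc_subset_Icc (le_max_left _ _) le_rfl
  have hsubM : Icc (max c (s - 2 * δ)) (min d (s + 2 * δ)) ⊆ Icc c d :=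
    Icc_subset_Icc (le_max_left _ _) (min_le_left _ _)
  obtain ⟨K₁, hK₁, H₁⟩ := exists_norm_cellError_sub_moment_le_of_far hγ (F' s) hδ
    (hu.imp (fun h => h.mono hsubL) (fun h => h.mono hsubL)) (fun x hx => hu0 x (hsubL hx))
    (hg.mono hsubL) (s := s) (fun x hx => by
      have := hx.2.trans (min_le_right _ _)
      rw [abs_of_nonpos (by linarith)]
      linarith)
  obtain ⟨K₂, hK₂, H₂⟩ := exists_norm_cellError_sub_moment_le_of_far hγ (F' s) hδ
    (hu.imp (fun h => h.mono hsubR) (fun h => h.mono hsubR)) (fun x hx => hu0 x (hsubR hx))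
    (hg.mono hsubR) (s := s) (fun x hx => by
      have := (le_max_right _ _).trans hx.1
      rw [abs_of_nonneg (by linarith)]
      linarith)
  obtain ⟨K₃, hK₃, H₃⟩ := exists_norm_cellError_sub_le (v := fun x => |x - s| ^ γ) hF
    ⟨by linarith, by linarith⟩ (le_max_right _ _) (min_le_right _ _) hu2
    (hg.continuousOn.mono hsubM) hFug (fun x => by positivity)
    (intervalIntegrable_abs_sub_rpow hγ s) (monotone_abs_sub_rpow_mul hγ s)
  have h1 : 0 < γ + 1 := by linarith
  refine ⟨K₁ + K₂ + K₃ * (1 / (γ + 1) + 1), by positivity, fun a b ha hab hb hlt => ?_⟩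
  have hW : 0 ≤ |b - s| ^ γ * (b - s) - |a - s| ^ γ * (a - s) :=
    sub_nonneg.2 (monotone_abs_sub_rpow_mul hγ s hab.le)
  have hΔ := abs_nonneg (u b - u a)
  have hba : 0 < b - a := sub_pos.2 hab
  have hK : 0 ≤ K₃ * (1 / (γ + 1) + 1) := by positivity
  by_cases hL : b ≤ s - δ
  · refine (H₁ a b ha hab (le_min hb hL)).trans ?_
    gcongr
    linarith
  by_cases hR : s + δ ≤ a
  · refine (H₂ a b (max_le ha hR) hab hb).trans ?_
    gcongr
    linarith
  -- A cell in neither far region comes within `δ` of `s`; being shorter than `δ`, it lies within `2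
  -- * δ` of `s`.
  refine (H₃ a b (max_le ha (by linarith)) hab (le_min hb (by linarith))).trans ?_
  rw [integral_abs_sub_rpow_eq hγ]
  set W := |b - s| ^ γ * (b - s) - |a - s| ^ γ * (a - s)
  rw [show K₃ * (b - a) ^ 2 * (W / (γ + 1) + W)
    = K₃ * (1 / (γ + 1) + 1) * (b - a) ^ 2 * W by ring]
  gcongr <;> linarith

/-- For a monotone function the variation along the grid telescopes. -/
lemma sum_abs_sub_le {u : ℝ → ℝ} {c d h : ℝ} (hh : 0 ≤ h)
    (hu : MonotoneOn u (Icc c d) ∨ AntitoneOn u (Icc c d)) {k l : ℕ} (hkl : k ≤ l)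
    (hk : c ≤ h * k) (hl : h * l ≤ d) :
    ∑ n ∈ Finset.Ico k l, |u (h * (n + 1)) - u (h * n)| ≤ |u d - u c| := by
  have key : ∀ w : ℝ → ℝ, MonotoneOn w (Icc c d) →
      ∑ n ∈ Finset.Ico k l, |w (h * (n + 1)) - w (h * n)| ≤ |w d - w c| := by
    intro w hw
    have hmem : ∀ n : ℕ, k ≤ n → n ≤ l → h * n ∈ Icc c d := by
      intro n h1 h2
      have h1' : (k : ℝ) ≤ n := by exact_mod_cast h1
      have h2' : (n : ℝ) ≤ l := by exact_mod_cast h2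
      exact ⟨hk.trans (by gcongr), le_trans (by gcongr) hl⟩
    have e : ∀ n ∈ Finset.Ico k l, |w (h * (n + 1)) - w (h * n)|
        = w (h * ((n + 1 : ℕ) : ℝ)) - w (h * n) := by
      intro n hn
      obtain ⟨h1, h2⟩ := Finset.mem_Ico.1 hn
      have := hw (hmem n h1 h2.le) (hmem (n + 1) (by omega) h2) (by push_cast; nlinarith)
      push_cast at this ⊢
      rw [abs_of_nonneg (by linarith)]
    rw [Finset.sum_congr rfl e, Finset.sum_Ico_sub (fun n : ℕ => w (h * n)) hkl]
    have hmk := hmem k le_rfl hkl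
    have hml := hmem l hkl le_rfl
    have hcd : c ≤ d := hmk.1.trans hmk.2
    have h1 := hw (left_mem_Icc.2 hcd) hmk hmk.1
    have h2 := hw hml (right_mem_Icc.2 hcd) hml.2
    exact le_trans (by linarith) (le_abs_self _)
  rcases hu with hu | hu
  · exact key u hu
  · have := key (fun x => -u x) hu.neg
    simpa only [← neg_sub', abs_neg] using this

lemma exists_norm_sum_cellError_sub_moment_le (hγ : -1 < γ) {u : ℝ → ℝ} {g F F' : ℝ → E}
    {c d s δ C : ℝ} (hδ : 0 < δ)
    (hu : MonotoneOn u (Icc c d) ∨ AntitoneOn u (Icc c d)) (hu0 : ∀ x ∈ Icc c d, 0 ≤ u x)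
    (hg : ContDiffOn ℝ 2 g (Icc c d))
    (hF : QuadApprox F F' C (Icc (s - 2 * δ) (s + 2 * δ)))
    (hu2 : ContDiffOn ℝ 2 u (Icc (max c (s - 2 * δ)) (min d (s + 2 * δ))))
    (hFug : ∀ x ∈ Icc (max c (s - 2 * δ)) (min d (s + 2 * δ)), F x = u x • g x) :
    ∃ K, 0 ≤ K ∧ ∀ (h : ℝ) (k l : ℕ), 0 < h → h < δ → k ≤ l → c ≤ h * k → h * l ≤ d →
      ‖∑ n ∈ Finset.Ico k l, (cellError u (fun x => |x - s| ^ γ) g (h * n) (h * (n + 1))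
          - moment γ s (h * n) (h * (n + 1)) • F' s)‖ ≤ K * h ^ 2 := by
  obtain ⟨K, hK, H⟩ := exists_norm_cellError_sub_moment_le hγ hδ hu hu0 hg hF hu2 hFug
  set w : ℝ → ℝ := fun x => |x - s| ^ γ * (x - s) with hw
  have hwm : Monotone w := monotone_abs_sub_rpow_mul hγ s
  -- The three terms are the total variations on `[c, d]` of the identity, `u` and `w`; none depends
  -- on the grid.
  refine ⟨K * (|d - c| + |u d - u c| + |w d - w c|), by positivity,
    fun h k l hh hhδ hkl hk hl => ?_⟩
  refine (norm_sum_le _ _).trans ?_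
  have hcell : ∀ n ∈ Finset.Ico k l,
      ‖cellError u (fun x => |x - s| ^ γ) g (h * n) (h * (n + 1))
          - moment γ s (h * n) (h * (n + 1)) • F' s‖
        ≤ K * h ^ 2 * (|id (h * (n + 1)) - id (h * n)| + |u (h * (n + 1)) - u (h * n)|
          + |w (h * (n + 1)) - w (h * n)|) := by
    intro n hn
    obtain ⟨h1, h2⟩ := Finset.mem_Ico.1 hn
    have h1' : (k : ℝ) ≤ n := by exact_mod_cast h1
    have h2' : (n : ℝ) + 1 ≤ l := by exact_mod_cast h2
    have e : h * (n + 1) - h * n = h := by ring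
    refine (H (h * n) (h * (n + 1)) (hk.trans (by gcongr)) (by linarith)
      (le_trans (by gcongr) hl) (by rwa [e])).trans ?_
    simp only [e, id]
    gcongr
    · exact le_abs_self _
    · exact le_abs_self (w (h * (n + 1)) - w (h * n))
  refine (Finset.sum_le_sum hcell).trans ?_
  rw [← Finset.mul_sum, Finset.sum_add_distrib, Finset.sum_add_distrib]
  have s1 := sum_abs_sub_le hh.le (Or.inl (monotone_id.monotoneOn (Icc c d))) hkl hk hl
  have s2 := sum_abs_sub_le hh.le hu hkl hk hl
  have s3 := sum_abs_sub_le hh.le (Or.inl (hwm.monotoneOn (Icc c d))) hkl hk hl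
  simp only [id] at s1
  rw [mul_right_comm]
  simp only [id]
  gcongr

lemma sum_abs_moment_le_of_far (hγ : -1 < γ) {s η h d : ℝ} (hη : 0 < η) (hh : 0 ≤ h)
    {k l : ℕ} (hkl : k ≤ l) (hl : h * l ≤ d)
    (hfar : ∀ n ∈ Finset.Ico k l, η ≤ |(h * n + h * (n + 1)) / 2 - s|) :
    |∑ n ∈ Finset.Ico k l, moment γ s (h * n) (h * (n + 1))|
      ≤ (1 / (γ + 1) + 1) / η * |(|d - s| ^ γ * (d - s) - |0 - s| ^ γ * (0 - s))| * h ^ 2 := by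
  have h1 : 0 < γ + 1 := by linarith
  set w : ℝ → ℝ := fun x => |x - s| ^ γ * (x - s) with hw
  have hwm : Monotone w := monotone_abs_sub_rpow_mul hγ s
  refine (Finset.abs_sum_le_sum_abs _ _).trans ?_
  have hcell : ∀ n ∈ Finset.Ico k l, |moment γ s (h * n) (h * (n + 1))|
      ≤ (1 / (γ + 1) + 1) / η * h ^ 2 * |w (h * (n + 1)) - w (h * n)| := by
    intro n hn
    have hM := abs_sub_mul_abs_moment_le hγ (s := s) (show h * n ≤ h * (n + 1) by nlinarith)
    have e : h * (n + 1) - h * n = h := by ring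
    rw [e] at hM
    rw [div_mul_eq_mul_div, div_mul_eq_mul_div, le_div_iff₀ hη, mul_comm]
    refine (mul_le_mul_of_nonneg_right (hfar n hn) (abs_nonneg _)).trans (hM.trans ?_)
    gcongr
    exact le_abs_self (w (h * (n + 1)) - w (h * n))
  refine (Finset.sum_le_sum hcell).trans ?_
  rw [← Finset.mul_sum, mul_right_comm]
  gcongr
  exact sum_abs_sub_le hh (Or.inl (hwm.monotoneOn (Icc 0 d))) hkl (by positivity) hl

end Cells

/-! ### Factoring powers of the sine through `sinc` -/

lemma contDiffOn_sinc_comp_rpow {φ : ℝ → ℝ} (p : ℝ) {S : Set ℝ} (hφ : ContDiff ℝ 2 φ)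
    (hS : ∀ x ∈ S, |φ x| < π) : ContDiffOn ℝ 2 (fun x => sinc (φ x) ^ p) S :=
  ((contDiff_sinc.comp hφ).contDiffOn).rpow_const_of_ne
    fun x hx => (sinc_pos_of_abs_lt_pi (hS x hx)).ne'

lemma abs_sin_rpow_eq (γ : ℝ) {x : ℝ} (hx : |x| < π) : |sin x| ^ γ = |x| ^ γ * sinc x ^ γ := by
  have h := (sinc_pos_of_abs_lt_pi hx).le
  rw [sin_eq_mul_sinc, abs_mul, abs_of_nonneg h, mul_rpow (abs_nonneg _) h]

lemma sin_rpow_eq (β : ℝ) {x : ℝ} (h0 : 0 ≤ x) (hx : x < π) :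
    sin x ^ β = x ^ β * sinc x ^ β := by
  rw [sin_eq_mul_sinc, mul_rpow h0 (sinc_pos_of_abs_lt_pi (by rwa [abs_of_nonneg h0])).le]

/-! ### Grid arithmetic and the total moment -/

section Nodes

variable {N r j : ℕ}

lemma step_pos (hN : 1 ≤ N) (hr : 1 ≤ r) : 0 < step N r := by
  have h1 : (0 : ℝ) < N := by exact_mod_cast hN
  have h2 : (0 : ℝ) < r := by exact_mod_cast hr
  unfold step
  positivity

lemma step_mul_eq (hN : 1 ≤ N) (hr : 1 ≤ r) : step N r * r = π / (2 * N) := by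
  have h1 : (N : ℝ) ≠ 0 := by positivity
  have h2 : (r : ℝ) ≠ 0 := by positivity
  unfold step
  field_simp

lemma step_mul_mul_eq (hN : 1 ≤ N) (hr : 1 ≤ r) : step N r * (r * N) = π / 2 := by
  have h1 : (N : ℝ) ≠ 0 := by positivity
  have h2 : (r : ℝ) ≠ 0 := by positivity
  unfold step
  field_simp

lemma evalNode_eq (hN : 1 ≤ N) (hr : 1 ≤ r) (j : ℕ) :
    evalNode N j = step N r * (((2 * j * r : ℕ) : ℝ) + r) := by
  have h1 : (N : ℝ) ≠ 0 := by positivity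
  have h2 : (r : ℝ) ≠ 0 := by positivity
  unfold step evalNode
  push_cast
  field_simp

lemma evalNode_pos (hN : 1 ≤ N) : 0 < evalNode N j := by
  have h1 : (0 : ℝ) < N := by exact_mod_cast hN
  unfold evalNode
  positivity

lemma evalNode_lt_pi (hj : j < N) : evalNode N j < π := by
  have h1 : (0 : ℝ) < N := by exact_mod_cast (by omega : 0 < N)
  have h2 : (j : ℝ) + 1 ≤ N := by exact_mod_cast hj
  unfold evalNode
  rw [div_lt_iff₀ (by positivity)]
  nlinarith [pi_pos]

/-- A parity argument: `s_j` is an integer multiple of the step, a midpoint a half-integer one.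
Hence the quotients in the quadrature sums are genuine values of `sinc`. -/
lemma gridPoint_midpoint_ne_evalNode (hN : 1 ≤ N) (hr : 1 ≤ r) (n j : ℕ) :
    gridPoint N r (n + 1 / 2) ≠ evalNode N j := by
  rw [evalNode_eq hN hr, gridPoint]
  intro h
  have h1 := mul_left_cancel₀ (step_pos hN hr).ne' h
  have h2 : (2 * n + 1 : ℝ) = 2 * ((2 * j * r : ℕ) + r) := by linarith
  have h3 : 2 * n + 1 = 2 * (2 * j * r + r) := by exact_mod_cast h2
  omega

lemma exists_abs_sum_moment_le {γ : ℝ} (hγ : -1 < γ) (hj : j < N) :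
    ∃ K, 0 ≤ K ∧ ∀ r, 1 ≤ r →
      |∑ n ∈ Finset.range (2 * r * N),
        moment γ (evalNode N j) (step N r * n) (step N r * (n + 1))| ≤ K * step N r ^ 2 := by
  have hN : 1 ≤ N := by omega
  have hN0 : (0 : ℝ) < N := by exact_mod_cast hN
  have h1 : 0 < γ + 1 := by linarith
  set s := evalNode N j with hs
  have hη : 0 < π / (2 * N) := by positivity
  set K := (1 / (γ + 1) + 1) / (π / (2 * N))
    * |(|π - s| ^ γ * (π - s) - |0 - s| ^ γ * (0 - s))| with hK
  refine ⟨K + K, by positivity, fun r hr => ?_⟩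
  have hh := step_pos hN hr
  have hsr := evalNode_eq hN hr j
  have hη' := step_mul_eq hN hr
  have hπ := step_mul_mul_eq hN hr
  rw [← hs] at hsr
  set h := step N r
  -- The symmetric window reaches `r` cells, a length `π / (2N)`, to each side of `s_j`, and fits
  -- inside the grid because `j + 1 ≤ N`.
  have hle : 2 * j * r + 2 * r ≤ 2 * r * N := by
    calc 2 * j * r + 2 * r = 2 * r * (j + 1) := by ring
      _ ≤ 2 * r * N := Nat.mul_le_mul_left _ hj
  have hend : h * ((2 * r * N : ℕ) : ℝ) ≤ π := by
    push_cast
    linarith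
  rw [← Nat.Ico_zero_eq_range, ← Finset.sum_Ico_consecutive _ (Nat.zero_le _) hle,
    ← Finset.sum_Ico_consecutive _ (Nat.zero_le _) (Nat.le_add_right (2 * j * r) (2 * r))]
  have hmid : ∑ n ∈ Finset.Ico (2 * j * r) (2 * j * r + 2 * r),
      moment γ s (h * n) (h * (n + 1)) = 0 := by
    rw [Finset.sum_Ico_eq_sum_range, Nat.add_sub_cancel_left, hsr]
    exact sum_moment_symmetric γ h (2 * j * r) r
  rw [hmid, add_zero, add_mul]
  refine (abs_add_le _ _).trans (add_le_add ?_ ?_)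
  · refine sum_abs_moment_le_of_far hγ hη hh.le (Nat.zero_le _) (le_trans ?_ hend)
      fun n hn => ?_
    · exact mul_le_mul_of_nonneg_left (by exact_mod_cast (Nat.le_add_right _ _).trans hle) hh.le
    · have h2 : (n : ℝ) + 1 ≤ (2 * j * r : ℕ) := by exact_mod_cast (Finset.mem_Ico.1 hn).2
      have h3 := mul_le_mul_of_nonneg_left h2 hh.le
      rw [abs_of_nonpos (by nlinarith)]
      nlinarith
  · refine sum_abs_moment_le_of_far hγ hη hh.le hle hend fun n hn => ?_
    have h2 : ((2 * j * r : ℕ) : ℝ) + 2 * r ≤ n := by exact_mod_cast (Finset.mem_Ico.1 hn).1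
    have h3 := mul_le_mul_of_nonneg_left h2 hh.le
    rw [abs_of_nonneg (by nlinarith)]
    nlinarith

end Nodes

/-! ### Regular factors and the global error -/

section Main

variable {𝕜 : Type*} [RCLike 𝕜]

lemma intervalIntegrable_integrand {f : ℝ → 𝕜} (hf : ContinuousOn f (Icc 0 π)) {β γ s : ℝ}
    (hβ : 0 < β) (hγ : -1 < γ) (h0 : 0 < s) (hπ : s < π) :
    IntervalIntegrable (integrand β γ f s) volume 0 π := by
  have h1 : ContinuousOn (fun x => (sin x ^ β * sinc (x - s) ^ γ) • f x) (uIcc 0 π) := by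
    rw [uIcc_of_le pi_pos.le]
    refine ContinuousOn.smul (ContinuousOn.mul ?_ ?_) hf
    · exact (continuous_sin.rpow_const fun x => Or.inr hβ.le).continuousOn
    · exact (contDiffOn_sinc_comp_rpow γ (contDiff_id.sub contDiff_const) fun x hx =>
        abs_lt.2 ⟨by simp only [id]; linarith [hx.1], by simp only [id]; linarith [hx.2]⟩).continuousOn
  refine ((intervalIntegrable_abs_sub_rpow hγ s 0 π).smul_continuousOn h1).congr fun x hx => ?_
  rw [uIoc_of_le pi_pos.le] at hx
  have : |x - s| < π := abs_lt.2 ⟨by linarith [hx.1], by linarith [hx.2]⟩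
  simp only [integrand, abs_sin_rpow_eq γ this, smul_smul]
  congr 1
  ring

/-- Regular factor of the integrand once `x ^ β` and `|x - s| ^ γ` are taken out. -/
noncomputable def regularLeft (β γ : ℝ) (f : ℝ → 𝕜) (s x : ℝ) : 𝕜 :=
  (sinc x ^ β * sinc (x - s) ^ γ) • f x

/-- Regular factor of the integrand once `(π - x) ^ β` and `|x - s| ^ γ` are taken out. -/
noncomputable def regularRight (β γ : ℝ) (f : ℝ → 𝕜) (s x : ℝ) : 𝕜 :=
  (sinc (π - x) ^ β * sinc (x - s) ^ γ) • f x

lemma integrand_eq_left {f : ℝ → 𝕜} {β γ s x : ℝ} (h0 : 0 < s) (hπ : s < π) (hx0 : 0 ≤ x)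
    (hx : x < π) :
    integrand β γ f s x = (x ^ β * |x - s| ^ γ) • regularLeft β γ f s x := by
  have : |x - s| < π := abs_lt.2 ⟨by linarith, by linarith⟩
  rw [integrand, regularLeft, smul_smul, abs_sin_rpow_eq γ this, sin_rpow_eq β hx0 hx]
  congr 1
  ring

lemma integrand_eq_right {f : ℝ → 𝕜} {β γ s x : ℝ} (h0 : 0 < s) (hπ : s < π) (hx0 : 0 < x)
    (hx : x ≤ π) :
    integrand β γ f s x = ((π - x) ^ β * |x - s| ^ γ) • regularRight β γ f s x := by
  have : |x - s| < π := abs_lt.2 ⟨by linarith, by linarith⟩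
  rw [integrand, regularRight, smul_smul, abs_sin_rpow_eq γ this, ← sin_pi_sub,
    sin_rpow_eq β (by linarith : 0 ≤ π - x) (by linarith)]
  congr 1
  ring

/-- `sinc` is positive on `(-π, π)`, so its real powers are C² there. Stopping at `π / 2` keeps `x`
away from the zero of `sinc` at `π`. -/
lemma contDiffOn_regularLeft {f : ℝ → 𝕜} (hf : ContDiffOn ℝ 2 f (Icc 0 π)) {β γ s : ℝ}
    (h0 : 0 < s) (hπ : s < π) : ContDiffOn ℝ 2 (regularLeft β γ f s) (Icc 0 (π / 2)) := by
  have hpi := pi_pos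
  refine ContDiffOn.smul (ContDiffOn.mul (𝔸 := ℝ) ?_ ?_) (hf.mono (Icc_subset_Icc_right (by linarith)))
  · exact contDiffOn_sinc_comp_rpow β contDiff_id fun x hx => by
      rw [abs_of_nonneg hx.1]
      linarith [hx.2]
  · exact contDiffOn_sinc_comp_rpow γ (by fun_prop) fun x hx =>
      abs_lt.2 ⟨by linarith [hx.1], by linarith [hx.2]⟩

lemma contDiffOn_regularRight {f : ℝ → 𝕜} (hf : ContDiffOn ℝ 2 f (Icc 0 π)) {β γ s : ℝ}
    (h0 : 0 < s) (hπ : s < π) : ContDiffOn ℝ 2 (regularRight β γ f s) (Icc (π / 2) π) := by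
  have hpi := pi_pos
  refine ContDiffOn.smul (ContDiffOn.mul (𝔸 := ℝ) ?_ ?_) (hf.mono (Icc_subset_Icc_left (by linarith)))
  · exact contDiffOn_sinc_comp_rpow β (by fun_prop) fun x hx =>
      abs_lt.2 ⟨by linarith [hx.2], by linarith [hx.1]⟩
  · exact contDiffOn_sinc_comp_rpow γ (by fun_prop) fun x hx =>
      abs_lt.2 ⟨by linarith [hx.1], by linarith [hx.2]⟩

lemma A₁_eq (f : ℝ → 𝕜) {β γ : ℝ} (hβ : 0 < β) (hγ : -1 < γ) {N r : ℕ} (hN : 1 ≤ N)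
    (hr : 1 ≤ r) (j : ℕ) :
    A₁ β γ f N r j = ∑ n ∈ Finset.Ico 0 (r * N),
      ((∫ x in step N r * n..step N r * (n + 1), x ^ β)
        * (∫ x in step N r * n..step N r * (n + 1), |x - evalNode N j| ^ γ)
        / (step N r * (n + 1) - step N r * n))
        • regularLeft β γ f (evalNode N j) ((step N r * n + step N r * (n + 1)) / 2) := by
  rw [A₁, Finset.smul_sum, Nat.Ico_zero_eq_range]
  refine Finset.sum_congr rfl fun n _ => ?_
  have hh := step_pos hN hr
  have hne := gridPoint_midpoint_ne_evalNode hN hr n j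
  have hm : (step N r * n + step N r * (n + 1)) / 2 = gridPoint N r (n + 1 / 2) := by
    rw [gridPoint]; ring
  have hm0 : gridPoint N r (n + 1 / 2) ≠ 0 := by
    rw [gridPoint]; positivity
  rw [hm, integral_abs_sub_rpow hγ, integral_rpow (Or.inl (by linarith)), regularLeft,
    sinc_of_ne_zero hm0, sinc_of_ne_zero (sub_ne_zero.2 hne), smul_smul, smul_smul,
    show step N r * (n + 1) - step N r * n = step N r by ring]
  congr 1
  simp only [gridPoint]
  ring

lemma integral_pi_sub_rpow {β : ℝ} (hβ : 0 < β) (a b : ℝ) :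
    ∫ x in a..b, (π - x) ^ β = ((π - a) ^ (β + 1) - (π - b) ^ (β + 1)) / (β + 1) := by
  rw [intervalIntegral.integral_comp_sub_left (fun x : ℝ => x ^ β) π,
    integral_rpow (Or.inl (by linarith))]

lemma A₂_eq (f : ℝ → 𝕜) {β γ : ℝ} (hβ : 0 < β) (hγ : -1 < γ) {N r : ℕ} (hN : 1 ≤ N)
    (hr : 1 ≤ r) (j : ℕ) :
    A₂ β γ f N r j = ∑ n ∈ Finset.Ico (r * N) (2 * r * N),
      ((∫ x in step N r * n..step N r * (n + 1), (π - x) ^ β)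
        * (∫ x in step N r * n..step N r * (n + 1), |x - evalNode N j| ^ γ)
        / (step N r * (n + 1) - step N r * n))
        • regularRight β γ f (evalNode N j) ((step N r * n + step N r * (n + 1)) / 2) := by
  rw [A₂, Finset.smul_sum]
  refine Finset.sum_congr rfl fun n hn => ?_
  have hh := step_pos hN hr
  have hne := gridPoint_midpoint_ne_evalNode hN hr n j
  have hm : (step N r * n + step N r * (n + 1)) / 2 = gridPoint N r (n + 1 / 2) := by
    rw [gridPoint]; ring
  have hm0 : π - gridPoint N r (n + 1 / 2) ≠ 0 := by
    have h1 : (n : ℝ) + 1 ≤ 2 * r * N := by exact_mod_cast (Finset.mem_Ico.1 hn).2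
    have h2 := step_mul_mul_eq hN hr
    have h3 := mul_le_mul_of_nonneg_left h1 hh.le
    rw [gridPoint]
    apply ne_of_gt
    nlinarith
  rw [hm, integral_abs_sub_rpow hγ, integral_pi_sub_rpow hβ, regularRight,
    sinc_of_ne_zero hm0, sin_pi_sub, sinc_of_ne_zero (sub_ne_zero.2 hne), smul_smul, smul_smul,
    show step N r * (n + 1) - step N r * n = step N r by ring]
  congr 1
  simp only [gridPoint]
  ring

lemma singularIntegral_sub_eq_sum_cellError {f : ℝ → 𝕜} (hf : ContinuousOn f (Icc 0 π))
    {β γ : ℝ} (hβ : 0 < β) (hγ : -1 < γ) {N r j : ℕ} (hr : 1 ≤ r) (hj : j < N) :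
    singularIntegral β γ f (evalNode N j) - A₁ β γ f N r j - A₂ β γ f N r j
      = (∑ n ∈ Finset.Ico 0 (r * N), cellError (fun x => x ^ β)
          (fun x => |x - evalNode N j| ^ γ) (regularLeft β γ f (evalNode N j))
          (step N r * n) (step N r * (n + 1)))
        + ∑ n ∈ Finset.Ico (r * N) (2 * r * N), cellError (fun x => (π - x) ^ β)
          (fun x => |x - evalNode N j| ^ γ) (regularRight β γ f (evalNode N j))
          (step N r * n) (step N r * (n + 1)) := by
  have hN : 1 ≤ N := by omega
  have hh := step_pos hN hr
  have h0 : 0 < evalNode N j := evalNode_pos hN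
  have hπ := evalNode_lt_pi hj
  have hπ2 := step_mul_mul_eq hN hr
  have hint := intervalIntegrable_integrand hf hβ hγ h0 hπ
  have hle : r * N ≤ 2 * r * N := by nlinarith [Nat.zero_le (r * N)]
  have hmem : ∀ n : ℕ, n ≤ 2 * r * N → step N r * n ∈ Icc 0 π := by
    intro n hn
    have h1 : (n : ℝ) ≤ 2 * r * N := by exact_mod_cast hn
    have h3 := mul_le_mul_of_nonneg_left h1 hh.le
    exact ⟨by positivity, by linarith⟩
  have hsplit : singularIntegral β γ f (evalNode N j)
      = ∑ n ∈ Finset.Ico 0 (2 * r * N),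
        ∫ x in step N r * n..step N r * (n + 1), integrand β γ f (evalNode N j) x := by
    have h := intervalIntegral.sum_integral_adjacent_intervals_Ico (μ := volume)
      (f := integrand β γ f (evalNode N j)) (a := fun n : ℕ => step N r * n)
      (Nat.zero_le (2 * r * N)) (fun n hn => hint.mono_set (by
        rw [uIcc_of_le pi_pos.le]
        exact (convex_Icc 0 π).ordConnected.uIcc_subset (hmem n hn.2.le) (hmem (n + 1) hn.2)))
    rw [show step N r * ((0 : ℕ) : ℝ) = 0 by simp,
      show step N r * ((2 * r * N : ℕ) : ℝ) = π by push_cast; linarith] at h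
    rw [singularIntegral, ← h]
    simp only [Nat.cast_add, Nat.cast_one]
  rw [hsplit, ← Finset.sum_Ico_consecutive _ (Nat.zero_le _) hle, A₁_eq f hβ hγ hN hr,
    A₂_eq f hβ hγ hN hr]
  simp only [cellError, Finset.sum_sub_distrib]
  have e1 : ∀ n ∈ Finset.Ico 0 (r * N),
      ∫ x in step N r * n..step N r * (n + 1), integrand β γ f (evalNode N j) x
        = ∫ x in step N r * n..step N r * (n + 1),
          (x ^ β * |x - evalNode N j| ^ γ) • regularLeft β γ f (evalNode N j) x := by
    intro n hn
    refine intervalIntegral.integral_congr fun x hx => ?_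
    rw [uIcc_of_le (by nlinarith)] at hx
    have h1 : (n : ℝ) + 1 ≤ r * N := by exact_mod_cast (Finset.mem_Ico.1 hn).2
    have h3 := mul_le_mul_of_nonneg_left h1 hh.le
    exact integrand_eq_left h0 hπ (le_trans (by positivity) hx.1) (by linarith [hx.2, pi_pos])
  have e2 : ∀ n ∈ Finset.Ico (r * N) (2 * r * N),
      ∫ x in step N r * n..step N r * (n + 1), integrand β γ f (evalNode N j) x
        = ∫ x in step N r * n..step N r * (n + 1),
          ((π - x) ^ β * |x - evalNode N j| ^ γ) • regularRight β γ f (evalNode N j) x := by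
    intro n hn
    refine intervalIntegral.integral_congr fun x hx => ?_
    rw [uIcc_of_le (by nlinarith)] at hx
    have h1 : (r : ℝ) * N ≤ n := by exact_mod_cast (Finset.mem_Ico.1 hn).1
    have h3 := mul_le_mul_of_nonneg_left h1 hh.le
    have h4 := (hmem (n + 1) (Finset.mem_Ico.1 hn).2).2
    push_cast at h4
    exact integrand_eq_right h0 hπ (by linarith [hx.1, pi_pos]) (hx.2.trans h4)
  rw [Finset.sum_congr rfl e1, Finset.sum_congr rfl e2]
  abel

lemma exists_norm_error_le_of_step_lt {f : ℝ → 𝕜} (hf : ContDiffOn ℝ 2 f (Icc 0 π))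
    {β γ : ℝ} (hβ : 0 < β) (hγ : -1 < γ) {N j : ℕ} (hj : j < N) :
    ∃ K δ : ℝ, 0 ≤ K ∧ 0 < δ ∧ ∀ r, 1 ≤ r → step N r < δ →
      ‖singularIntegral β γ f (evalNode N j) - A₁ β γ f N r j - A₂ β γ f N r j‖
        ≤ K * step N r ^ 2 := by
  have hN : 1 ≤ N := by omega
  have h0 : 0 < evalNode N j := evalNode_pos hN
  have hπ := evalNode_lt_pi hj
  obtain ⟨K₃, hK₃, H₃⟩ := exists_abs_sum_moment_le hγ hj
  have hcell := fun r (hr : 1 ≤ r) =>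
    singularIntegral_sub_eq_sum_cellError hf.continuousOn hβ hγ (r := r) hr hj
  set s := evalNode N j
  have hpi := pi_pos
  -- This puts the `2 * δ` neighbourhood of `s` inside `(0, π)`, where `sin` is positive and `sin ^
  -- β` is C².
  obtain ⟨δ, hδ, hδ1, hδ2⟩ : ∃ δ, 0 < δ ∧ 2 * δ < s ∧ 2 * δ < π - s := by
    refine ⟨min s (π - s) / 4, by have := lt_min h0 (sub_pos.2 hπ); positivity, ?_, ?_⟩
    · linarith [min_le_left s (π - s)]
    · linarith [min_le_right s (π - s)]
  -- This function equals `u g` on both sides of `π / 2`, so the two halves share one slope `F' s`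
  -- and their moments can be added before cancelling, even if the symmetric window straddles `π /
  -- 2`.
  have hF2 : ContDiffOn ℝ 2 (fun x => (sin x ^ β * sinc (x - s) ^ γ) • f x)
      (Icc (s - 2 * δ) (s + 2 * δ)) := by
    refine ContDiffOn.smul (ContDiffOn.mul (𝔸 := ℝ) ?_ ?_)
      (hf.mono (Icc_subset_Icc (by linarith) (by linarith)))
    · exact contDiff_sin.contDiffOn.rpow_const_of_ne fun x hx =>
        (sin_pos_of_pos_of_lt_pi (by linarith [hx.1]) (by linarith [hx.2])).ne'
    · exact contDiffOn_sinc_comp_rpow γ (by fun_prop) fun x hx =>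
        abs_lt.2 ⟨by linarith [hx.1], by linarith [hx.2]⟩
  obtain ⟨F', C, hF⟩ := exists_quadApprox hF2
  obtain ⟨K₁, hK₁, H₁⟩ := exists_norm_sum_cellError_sub_moment_le hγ hδ
    (u := fun x => x ^ β) (g := regularLeft β γ f s) (c := 0) (d := π / 2)
    (Or.inl fun x hx y _ hxy => rpow_le_rpow hx.1 hxy hβ.le)
    (fun x hx => rpow_nonneg hx.1 _) (contDiffOn_regularLeft hf h0 hπ) hF
    (contDiffOn_id.rpow_const_of_ne fun x hx => by
      have := (le_max_right _ _).trans hx.1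
      exact ne_of_gt (by simp only [id]; linarith))
    (fun x hx => by
      have h1 := (le_max_left _ _).trans hx.1
      have h2 := hx.2.trans (min_le_left _ _)
      rw [regularLeft, smul_smul, sin_rpow_eq β h1 (by linarith), mul_assoc])
  obtain ⟨K₂, hK₂, H₂⟩ := exists_norm_sum_cellError_sub_moment_le hγ hδ
    (u := fun x => (π - x) ^ β) (g := regularRight β γ f s) (c := π / 2) (d := π)
    (Or.inr fun x _ y hy hxy => rpow_le_rpow (by linarith [hy.2]) (by linarith) hβ.le)
    (fun x hx => rpow_nonneg (by linarith [hx.2]) _) (contDiffOn_regularRight hf h0 hπ) hF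
    ((contDiff_const.sub contDiff_id).contDiffOn.rpow_const_of_ne fun x hx => by
      have := hx.2.trans (min_le_right _ _)
      exact ne_of_gt (by simp only [id]; linarith))
    (fun x hx => by
      have h1 := (le_max_left _ _).trans hx.1
      have h2 := hx.2.trans (min_le_left _ _)
      rw [regularRight, smul_smul, ← sin_pi_sub,
        sin_rpow_eq β (by linarith : 0 ≤ π - x) (by linarith), mul_assoc])
  refine ⟨K₁ + K₂ + K₃ * ‖F' s‖, δ, by positivity, hδ, fun r hr hlt => ?_⟩
  have hh := step_pos hN hr
  have hπ2 := step_mul_mul_eq hN hr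
  have hle : r * N ≤ 2 * r * N := by nlinarith [Nat.zero_le (r * N)]
  have b1 := H₁ (step N r) 0 (r * N) hh hlt (Nat.zero_le _) (by simp) (by
    push_cast; exact hπ2.le)
  have b2 := H₂ (step N r) (r * N) (2 * r * N) hh hlt hle (by push_cast; exact hπ2.ge) (by
    push_cast; linarith)
  have b3 := H₃ r hr
  rw [← Nat.Ico_zero_eq_range, ← Finset.sum_Ico_consecutive _ (Nat.zero_le _) hle] at b3
  rw [Finset.sum_sub_distrib, ← Finset.sum_smul] at b1 b2
  rw [hcell r hr]
  set X₁ := ∑ n ∈ Finset.Ico 0 (r * N), cellError (fun x => x ^ β)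
    (fun x => |x - s| ^ γ) (regularLeft β γ f s) (step N r * n) (step N r * (n + 1))
  set X₂ := ∑ n ∈ Finset.Ico (r * N) (2 * r * N), cellError (fun x => (π - x) ^ β)
    (fun x => |x - s| ^ γ) (regularRight β γ f s) (step N r * n) (step N r * (n + 1))
  set M₁ := ∑ n ∈ Finset.Ico 0 (r * N), moment γ s (step N r * n) (step N r * (n + 1))
  set M₂ := ∑ n ∈ Finset.Ico (r * N) (2 * r * N),
    moment γ s (step N r * n) (step N r * (n + 1))
  have e : X₁ + X₂ = (X₁ - M₁ • F' s) + (X₂ - M₂ • F' s) + (M₁ + M₂) • F' s := by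
    rw [add_smul]; abel
  rw [e]
  have b4 : ‖(M₁ + M₂) • F' s‖ ≤ K₃ * step N r ^ 2 * ‖F' s‖ := by
    rw [norm_smul]
    exact mul_le_mul_of_nonneg_right b3 (norm_nonneg _)
  have := norm_add₃_le (a := X₁ - M₁ • F' s) (b := X₂ - M₂ • F' s) (c := (M₁ + M₂) • F' s)
  linarith

/-- A bound `K / r ^ 2` that holds for each index and all large `r` holds uniformly, with another
constant, over finitely many indices and all `r ≥ 1`. -/
lemma exists_uniform_bound {e : ℕ → ℕ → ℝ} {N : ℕ}
    (h : ∀ j, j < N → ∃ (K : ℝ) (R : ℕ), 0 ≤ K ∧ ∀ r, 1 ≤ r → R ≤ r → e r j ≤ K / (r : ℝ) ^ 2) :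
    ∃ K : ℝ, 0 < K ∧ ∀ r, 1 ≤ r → ∀ j, j < N → e r j ≤ K / (r : ℝ) ^ 2 := by
  choose! K R hK H using h
  -- `B j` absorbs the finitely many `r` below the threshold `R j`.
  set B : ℕ → ℝ := fun j => ∑ r ∈ Finset.range (R j), |e r j| * (r : ℝ) ^ 2
  have hB : ∀ j, 0 ≤ B j := fun j => Finset.sum_nonneg fun r _ => by positivity
  have hterm : ∀ j ∈ Finset.range N, 0 ≤ K j + B j := fun j hj =>
    add_nonneg (hK j (Finset.mem_range.1 hj)) (hB j)
  refine ⟨1 + ∑ j ∈ Finset.range N, (K j + B j),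
    by linarith [Finset.sum_nonneg hterm], fun r hr j hj => ?_⟩
  have hr0 : (0 : ℝ) < r := by exact_mod_cast hr
  have hsum := Finset.single_le_sum hterm (Finset.mem_range.2 hj)
  have hKj := hK j hj
  have hBj := hB j
  rcases le_or_gt (R j) r with hR | hR
  · refine (H j hj r hr hR).trans ?_
    gcongr
    linarith
  · have h1 : |e r j| * (r : ℝ) ^ 2 ≤ B j :=
      Finset.single_le_sum (f := fun r : ℕ => |e r j| * (r : ℝ) ^ 2)
        (fun r _ => by positivity) (Finset.mem_range.2 hR)
    rw [le_div_iff₀ (by positivity)]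
    have h2 := mul_le_mul_of_nonneg_right (le_abs_self (e r j)) (by positivity : 0 ≤ (r : ℝ) ^ 2)
    linarith

end Main

end SingularQuadrature

theorem mainTheorem2 {𝕜 : Type*} [RCLike 𝕜] (f : ℝ → 𝕜)
    (hf : ContDiffOn ℝ 2 f (Set.Icc 0 π)) (β γ : ℝ) (hβ : 0 < β) (hγ : -1 < γ)
    (N : ℕ) (hN : 1 ≤ N) :
    (∀ j : ℕ, j < N →
      IntervalIntegrable
        (SingularQuadrature.integrand β γ f (SingularQuadrature.evalNode N j))
        MeasureTheory.volume 0 π) ∧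
    ∃ K : ℝ, 0 < K ∧ ∀ r : ℕ, 1 ≤ r → ∀ j : ℕ, j < N →
      ‖SingularQuadrature.singularIntegral β γ f (SingularQuadrature.evalNode N j)
          - SingularQuadrature.A₁ β γ f N r j - SingularQuadrature.A₂ β γ f N r j‖
        ≤ K / (r : ℝ) ^ 2 := by
  refine ⟨fun j hj => SingularQuadrature.intervalIntegrable_integrand hf.continuousOn hβ hγ
    (SingularQuadrature.evalNode_pos hN) (SingularQuadrature.evalNode_lt_pi hj), ?_⟩
  refine SingularQuadrature.exists_uniform_bound (e := fun r j =>
    ‖SingularQuadrature.singularIntegral β γ f (SingularQuadrature.evalNode N j)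
      - SingularQuadrature.A₁ β γ f N r j - SingularQuadrature.A₂ β γ f N r j‖) fun j hj => ?_
  obtain ⟨K, δ, hK, hδ, H⟩ := SingularQuadrature.exists_norm_error_le_of_step_lt hf hβ hγ hj
  have hN0 : (0 : ℝ) < N := by exact_mod_cast hN
  -- The step is `π / (2 * N) / r`, hence below `δ` as soon as `r ≥ R`.
  obtain ⟨R, hR⟩ := exists_nat_gt (π / (2 * N) / δ)
  refine ⟨K * (π / (2 * N)) ^ 2, R, by positivity, fun r hr hRr => ?_⟩
  have hr0 : (0 : ℝ) < r := by exact_mod_cast hr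
  have hstep : SingularQuadrature.step N r = π / (2 * N) / r := by
    rw [← SingularQuadrature.step_mul_eq hN hr, mul_div_cancel_right₀ _ hr0.ne']
  have hlt : SingularQuadrature.step N r < δ := by
    have h1 : (R : ℝ) ≤ r := by exact_mod_cast hRr
    rw [hstep, div_lt_iff₀ hr0, ← div_lt_iff₀' hδ]
    linarith
  refine (H r hr hlt).trans (le_of_eq ?_)
  rw [hstep]
  ring
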